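/- Consider the p-system $v_t-u_x=0$, $u_t+p_x=0$ with $v=1/\rho$ and $p=\rho^3/3$, with Riemann invariants $w_1=\rho-u$, $w_2=\rho+u$. For left state $U^-=(u^-,\rho^-)$ and right state $U^+=(u^+,\rho^+)$ with positive densities, an elementary 1-wave is either a 1-rarefaction ($w_2^-=w_2^+$, $\rho^+\le\rho^-$) or a 1-shock ($\rho^+>\rho^-$ and the Rankine--Hugoniot equations hold for some speed $\lambda<0$); an elementary 2-wave is either a 2-rarefaction ($w_1^-=w_1^+$, $\rho^-\le\rho^+$) or a 2-shock ($\rho^+<\rho^-$ and the Rankine--Hugoniot equations hold for some speed $\lambda>0$). The exact Riemann solution consists of a 1-wave followed by a 2-wave. For $c>0$, a *front tracking approximate solution with speeds $\pm c$ and exact wave strengths* is a map $(t,x)\mapsto U=(u,\rho)$, $t\ge0$, $\rho\ge0$, with right continuous profiles, for which there are finitely many jump fronts, 1-fronts $x=a-ct$ $(a\in A)$ and 2-fronts $x=b+ct$ $(b\in B)$, such that: (i) $U(t,\cdot)$ is continuous away from the jump fronts; (ii) the continuous waves (rarefactions and compressions, regarded as continua of infinitesimal fronts) travel with the same speeds and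 cross each other with unchanged strength, i.e. $w_1$ is constant along each line $x=y-ct$ with $y\notin A$ as long as this line meets no 2-front, and $w_2$ is constant along each line $x=y+ct$ with $y\notin B$ as long as this line meets no 1-front; (iii) at every $(t,x)$, $t\geq 0$, with $\rho(t,x)>0$ the limits $U(t,x-)=L$ and $U(t',x')\to M$ as $(t',x')\to(t,x)$ in the sector $t'>t$, $|x'-x|<c(t'-t)$, exist, and $M$ is the middle state of the exact Riemann solution with left state $L$ and right state $U(t,x)=U(t,x+)$. In particular, at every interaction the outgoing wave strengths are those of the exact Riemann solution. **Statement.** There are an initial profile $(\bar u,\bar\rho)$ of bounded variation on $\mathbb R$ and a $\rho_0>0$ with $\bar\rho(x)\ge\rho_0$ for all $x$, such that for every $c>0$ there exist a front tracking approximate solution $U=(u,\rho)$ with speeds $\pm c$ and exact wave strengths, with $U(0,\cdot)=(\bar u,\bar\rho)$, times $0<t_2<t_3$ and a point $x_2$ such that: 1. $\rho(t,x)>0$ for all $t\ge0$ and $x\in\mathbb R$ with $(t,x)\ne(t_2,x_2)$; 2. the total variation blows up at time $t_2$: $u(t,\cdot)$ and $\rho(t,\cdot)$ have bounded variation on $\mathbb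 R$ for $0\le t<t_2$, and $\mathrm{Tot.Var.}\{\rho(t,\cdot);\mathbb R\}\to\infty$ as $t\to t_2-$; 3. $\rho(t_3,x)\ge1$ for all $x\ge0$, and $\mathrm{Tot.Var.}\{\rho(t_3,\cdot);[0,\infty)\}=\infty$; 4. no continuous weights on wave strengths control the total variation: for all functions $W_1,W_2$ of the left and right state of a wave that are continuous and positive on the set where both densities are positive (with no restriction near vacuum), the weighted total variation of $U(0,\cdot)$ on $\mathbb R$ is finite, while that of $U(t_3,\cdot)$ on $[0,\infty)$ is infinite. Here the weighted total variation of a profile $V$ on a set $S\subseteq\mathbb R$ is the limit superior, as the finite set $\{y_0<\dots<y_n\}\subset S$ is refined, of $\sum_{i=1}^n \big(W_1(V(y_{i-1}),V(y_i))\,|w_1(V(y_i))-w_1(V(y_{i-1}))|+W_2(V(y_{i-1}),V(y_i))\,|w_2(V(y_i))-w_2(V(y_{i-1}))|\big)$. -/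

import Mathlib

open Set Filter Topology
open scoped ENNReal

namespace PSystem

/-- A gas state `(u, ρ)`: velocity and density. -/
abbrev State := ℝ × ℝ

/-- The first Riemann invariant `w₁ = ρ - u`. -/
def w₁ (U : State) : ℝ := U.2 - U.1

/-- The second Riemann invariant `w₂ = ρ + u`. -/
def w₂ (U : State) : ℝ := U.2 + U.1

/-- The Rankine-Hugoniot equations of `v_t - u_x = 0`, `u_t + p_x = 0`, with `v = 1 / ρ` and
`p = ρ ^ 3 / 3`, for a jump of speed `s` with left state `U` and right state `V`. -/
def RankineHugoniot (s : ℝ) (U V : State) : Prop :=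
  s * (1 / V.2 - 1 / U.2) = U.1 - V.1 ∧ s * (V.1 - U.1) = V.2 ^ 3 / 3 - U.2 ^ 3 / 3

/-- `U` (left) and `V` (right) are joined by an elementary wave of the first family: a centered
1-rarefaction (possibly of strength zero) or an entropy admissible 1-shock. -/
def Wave₁ (U V : State) : Prop :=
  0 < U.2 ∧ 0 < V.2 ∧
    ((w₂ U = w₂ V ∧ V.2 ≤ U.2) ∨ (U.2 < V.2 ∧ ∃ s < 0, RankineHugoniot s U V))

/-- `U` (left) and `V` (right) are joined by an elementary wave of the second family: a centered
2-rarefaction (possibly of strength zero) or an entropy admissible 2-shock. -/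
def Wave₂ (U V : State) : Prop :=
  0 < U.2 ∧ 0 < V.2 ∧
    ((w₁ U = w₁ V ∧ U.2 ≤ V.2) ∨ (V.2 < U.2 ∧ ∃ s > 0, RankineHugoniot s U V))

/-- `M` is the middle state of the exact solution of the Riemann problem with left state `L` and
right state `R`: a 1-wave from `L` to `M` followed by a 2-wave from `M` to `R`. -/
def RiemannMiddle (L M R : State) : Prop := Wave₁ L M ∧ Wave₂ M R

/-- The space-time sector issuing upwards from `(t, x)` and bounded by the two lines of
speed `-c` and `c`. -/
def upperSector (c t x : ℝ) : Set (ℝ × ℝ) := {p | t < p.1 ∧ |p.2 - x| < c * (p.1 - t)}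

/-- `U t x`, for `t ≥ 0`, is a front tracking approximate solution in which all 1-waves travel with
speed `-c`, all 2-waves travel with speed `c`, and wave strengths are exact.
There are finitely many jump fronts: the 1-fronts `x = a - c t` with `a ∈ A` and the 2-fronts
`x = b + c t` with `b ∈ B`. All the other waves are continuous. -/
def IsFrontTracking (c : ℝ) (U : ℝ → ℝ → State) : Prop :=
  (∀ t ≥ 0, ∀ x, 0 ≤ (U t x).2) ∧
  -- profiles are right continuous
  (∀ t ≥ 0, ∀ x, ContinuousWithinAt (U t) (Ici x) x) ∧
  -- at every point without vacuum the waves leaving the point are those of the exact solution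
  -- of the Riemann problem determined by the one-sided limits of the profile there
  (∀ t ≥ 0, ∀ x, 0 < (U t x).2 → ∃ L M : State,
    Tendsto (U t) (𝓝[<] x) (𝓝 L) ∧
    Tendsto (fun p : ℝ × ℝ => U p.1 p.2) (𝓝[upperSector c t x] (t, x)) (𝓝 M) ∧
    RiemannMiddle L M (U t x)) ∧
  ∃ A B : Finset ℝ,
    -- profiles are continuous away from the jump fronts
    (∀ t ≥ 0, ∀ x, x + c * t ∉ A → x - c * t ∉ B → ContinuousAt (U t) x) ∧
    -- until they meet a jump front of the other family, continuous 1-waves are carried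
    -- along `x = y - c t` with unchanged `w₁` ...
    (∀ y, y ∉ A → ∀ t t', 0 ≤ t → t ≤ t' →
      (∀ r ∈ Icc t t', (y - c * r) - c * r ∉ B) →
      w₁ (U t' (y - c * t')) = w₁ (U t (y - c * t))) ∧
    -- ... and continuous 2-waves along `x = y + c t` with unchanged `w₂`
    (∀ y, y ∉ B → ∀ t t', 0 ≤ t → t ≤ t' →
      (∀ r ∈ Icc t t', (y + c * r) + c * r ∉ A) →
      w₂ (U t' (y + c * t')) = w₂ (U t (y + c * t)))

/-- The total strength of the waves of the profile `V` seen on a list of points, the change of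
`w₁` (resp. `w₂`) between the states `P` and `Q` being weighted by `W₁ (P, Q)`
(resp. `W₂ (P, Q)`). -/
noncomputable def weightedSum (W₁ W₂ : State × State → ℝ) (V : ℝ → State) : List ℝ → ℝ≥0∞
  | x :: y :: l =>
      ENNReal.ofReal (W₁ (V x, V y) * |w₁ (V y) - w₁ (V x)| +
        W₂ (V x, V y) * |w₂ (V y) - w₂ (V x)|) + weightedSum W₁ W₂ V (y :: l)
  | _ => 0

/-- The weighted total variation of the profile `V` on `S`: the limit (superior) of the weighted
sums over the finite subsets of `S`, as these are refined. -/
noncomputable def weightedVariation (W₁ W₂ : State × State → ℝ) (V : ℝ → State) (S : Set ℝ) :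
    ℝ≥0∞ :=
  limsup (fun F : Finset S => weightedSum W₁ W₂ V ((F.sort (· ≤ ·)).map (fun x => (x : ℝ)))) atTop

/-- A weight on wave strengths: a function of the left and right states of a wave, continuous and
positive where the densities are positive, with no restriction on its behaviour near vacuum. -/
def IsWeight (W : State × State → ℝ) : Prop :=
  ContinuousOn W {p | 0 < p.1.2 ∧ 0 < p.2.2} ∧ ∀ p : State × State, 0 < p.1.2 → 0 < p.2.2 → 0 < W p

end PSystem

/-!
Consider a single 1-shock, the line `x = 1 - c t`, across which `w₁` jumps by the constant `1`.
Parametrise it by the square root `s` of the ratio of the densities on its two sides: on the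
Hugoniot curve the density is of order `s ^ 3` on the left of the shock and of order `s` on its
right. A continuous 2-wave which crosses the shock therefore enters with `w₂` of order `s ^ 3` and
leaves with `w₂ + 1` of order `s`. Near the 2-wave `q = 0` let `s` oscillate with amplitude
comparable to `|q|` and frequency comparable to `1 / q ^ 2`. Since `|ds|` is of order `dq / |q|`,
the incoming profile `s ^ 3` is Lipschitz while the transmitted one has infinite variation. The
variation is finite until the shock meets `q = 0` at the point `(1 / (2 c), 1 / 2)`, the only point
where there is vacuum, and it stays infinite when later 1-waves have raised the density, where
every weight is bounded from below.
-/

namespace PSystem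

section Variation

variable {α E F : Type*} [LinearOrder α]

theorem eVariationOn_prodMk_le [PseudoEMetricSpace E] [PseudoEMetricSpace F] (f : α → E)
    (g : α → F) (s : Set α) :
    eVariationOn (fun x => (f x, g x)) s ≤ eVariationOn f s + eVariationOn g s := by
  refine iSup_le fun ⟨n, u, hu, hs⟩ => ?_
  calc ∑ i ∈ Finset.range n, edist (f (u (i + 1)), g (u (i + 1))) (f (u i), g (u i))
      ≤ ∑ i ∈ Finset.range n,
          (edist (f (u (i + 1))) (f (u i)) + edist (g (u (i + 1))) (g (u i))) :=
        Finset.sum_le_sum fun _ _ => max_le_add_of_nonneg zero_le zero_le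
    _ ≤ eVariationOn f s + eVariationOn g s := by
        rw [Finset.sum_add_distrib]
        exact add_le_add (eVariationOn.sum_le hu hs) (eVariationOn.sum_le hu hs)

theorem boundedVariationOn_prodMk [PseudoEMetricSpace E] [PseudoEMetricSpace F] {f : α → E}
    {g : α → F} {s : Set α} (hf : BoundedVariationOn f s) (hg : BoundedVariationOn g s) :
    BoundedVariationOn (fun x => (f x, g x)) s :=
  ne_top_of_le_ne_top (ENNReal.add_ne_top.2 ⟨hf, hg⟩) (eVariationOn_prodMk_le f g s)

theorem boundedVariationOn_prod_iff [PseudoEMetricSpace E] [PseudoEMetricSpace F] {f : α → E × F}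
    {s : Set α} : BoundedVariationOn f s ↔
      BoundedVariationOn (fun x => (f x).1) s ∧ BoundedVariationOn (fun x => (f x).2) s :=
  ⟨fun h => ⟨LipschitzWith.prod_fst.comp_boundedVariationOn h,
    LipschitzWith.prod_snd.comp_boundedVariationOn h⟩, fun h => boundedVariationOn_prodMk h.1 h.2⟩

theorem boundedVariationOn_add [SeminormedAddCommGroup E] {f g : α → E} {s : Set α}
    (hf : BoundedVariationOn f s) (hg : BoundedVariationOn g s) :
    BoundedVariationOn (f + g) s :=
  (LipschitzWith.prod_fst.add LipschitzWith.prod_snd).comp_boundedVariationOn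
    (boundedVariationOn_prodMk hf hg)

theorem boundedVariationOn_sub [SeminormedAddCommGroup E] {f g : α → E} {s : Set α}
    (hf : BoundedVariationOn f s) (hg : BoundedVariationOn g s) :
    BoundedVariationOn (f - g) s :=
  (LipschitzWith.prod_fst.sub LipschitzWith.prod_snd).comp_boundedVariationOn
    (boundedVariationOn_prodMk hf hg)

theorem boundedVariationOn_mul_add_const {f : α → ℝ} {s : Set α} (hf : BoundedVariationOn f s)
    (c d : ℝ) : BoundedVariationOn (fun x => c * f x + d) s :=
  ((lipschitzWith_smul c).add (LipschitzWith.const d)).comp_boundedVariationOn hf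

theorem boundedVariationOn_comp_monotone {β : Type*} [LinearOrder β] [PseudoEMetricSpace E]
    {f : α → E} {φ : β → α} {s : Set α} {t : Set β} (hf : BoundedVariationOn f s)
    (hφ : Monotone φ) (h : MapsTo φ t s) : BoundedVariationOn (fun x => f (φ x)) t :=
  ne_top_of_le_ne_top hf (eVariationOn.comp_le_of_monotoneOn f φ (hφ.monotoneOn t) h)

theorem boundedVariationOn_ite_lt {f g : α → ℝ} {a : α} (hf : BoundedVariationOn f (Iic a))
    (hg : BoundedVariationOn g (Ici a)) :
    BoundedVariationOn (fun x => if x < a then f x else g x) univ := by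
  have hF : BoundedVariationOn (fun x => f (min x a)) univ :=
    boundedVariationOn_comp_monotone hf (monotone_id.min monotone_const)
      fun _ _ => min_le_right _ _
  have hG : BoundedVariationOn (fun x => g (max x a)) univ :=
    boundedVariationOn_comp_monotone hg (monotone_id.max monotone_const)
      fun _ _ => le_max_right _ _
  have hstep : BoundedVariationOn (fun x => if x < a then (0 : ℝ) else 1) univ := by
    refine MonotoneOn.boundedVariationOn (C := 1) (fun x _ y _ hxy => ?_) fun x _ => ?_
    · split_ifs with hx hy
      exacts [le_rfl, zero_le_one, absurd (hxy.trans_lt ‹y < a›) hx, le_rfl]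
    · split_ifs <;> simp
  have hpieces : (fun x => if x < a then f x else g x) = (fun x => f (min x a)) +
      (fun x => if x < a then (0 : ℝ) else 1) *
        ((fun x => g (max x a)) - fun x => f (min x a)) := by
    funext x
    simp only [Pi.add_apply, Pi.mul_apply, Pi.sub_apply]
    split_ifs with hx
    · rw [min_eq_left hx.le]
      ring
    · rw [max_eq_left (not_lt.1 hx)]
      ring
  rw [hpieces]
  exact boundedVariationOn_add hF (hstep.mul (boundedVariationOn_sub hG hF))

theorem eVariationOn_eq_iSup_finset [PseudoEMetricSpace E] (f : α → E) (s : Set α) :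
    eVariationOn f s = ⨆ T : Finset s, eVariationOn f (Subtype.val '' (T : Set s)) := by
  classical
  refine le_antisymm (iSup_le fun ⟨n, u, hu, hs⟩ => ?_)
    (iSup_le fun T => eVariationOn.mono f (Subtype.coe_image_subset s T))
  refine le_iSup_of_le ((Finset.range (n + 1)).image fun i => ⟨u i, hs i⟩) ?_
  refine eVariationOn.sum_le_of_monotoneOn_Iic (hu.monotoneOn _) fun i hi => ?_
  exact ⟨⟨u i, hs i⟩, Finset.mem_coe.2 (Finset.mem_image_of_mem _
    (Finset.mem_range.2 (Nat.lt_succ_of_le hi))), rfl⟩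

theorem tendsto_eVariationOn_finset [PseudoEMetricSpace E] (f : α → E) (s : Set α) :
    Tendsto (fun T : Finset s => eVariationOn f (Subtype.val '' (T : Set s))) atTop
      (𝓝 (eVariationOn f s)) := by
  rw [eVariationOn_eq_iSup_finset]
  exact tendsto_atTop_iSup fun T T' h => eVariationOn.mono f (image_mono (Finset.coe_subset.2 h))

theorem tendsto_eVariationOn_top {ι : Type*} [PseudoEMetricSpace E] {f : ι → α → E} {g : α → E}
    {l : Filter ι} {s : Set α} (hlim : ∀ x ∈ s, Tendsto (fun i => f i x) l (𝓝 (g x)))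
    (hg : eVariationOn g s = ⊤) : Tendsto (fun i => eVariationOn (f i) s) l (𝓝 ⊤) :=
  ENNReal.tendsto_nhds_top_iff_nnreal.2 fun _ =>
    eVariationOn.lowerSemicontinuous_aux hlim (hg ▸ ENNReal.coe_lt_top)

theorem tsum_edist_le_eVariationOn [PseudoEMetricSpace E] (f : ℕ → E) :
    ∑' k, edist (f (2 * k + 1)) (f (2 * k)) ≤ eVariationOn f univ := by
  refine ENNReal.tsum_le_of_sum_range_le fun n => ?_
  refine le_trans ?_ (eVariationOn.sum_le (n := 2 * n) monotone_id fun _ => mem_univ _)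
  induction n with
  | zero => simp
  | succ n ih =>
    rw [Finset.sum_range_succ, Nat.mul_succ, Finset.sum_range_succ, Finset.sum_range_succ]
    exact (add_le_add_left ih _).trans le_self_add

theorem eVariationOn_mem_cons_cons [PseudoEMetricSpace E] (f : α → E) {x y : α} {l : List α}
    (h : (x :: y :: l).Pairwise (· ≤ ·)) :
    eVariationOn f {z | z ∈ x :: y :: l} =
      edist (f x) (f y) + eVariationOn f {z | z ∈ y :: l} := by
  obtain ⟨hx, hl⟩ := List.pairwise_cons.1 h
  have hy : IsLeast {z | z ∈ y :: l} y :=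
    ⟨List.mem_cons_self,
      fun z hz => (List.mem_cons.1 hz).elim Eq.ge ((List.pairwise_cons.1 hl).1 z)⟩
  have hunion : {z | z ∈ x :: y :: l} = {x} ∪ {z | z ∈ y :: l} := by ext z; simp
  rw [hunion, eVariationOn.union' f isGreatest_singleton hy (hx y List.mem_cons_self),
    eVariationOn.subsingleton f subsingleton_singleton, zero_add]

theorem lipschitzOnWith_of_le {f : ℝ → ℝ} {K : NNReal} {s : Set ℝ}
    (h : ∀ x ∈ s, ∀ y ∈ s, x ≤ y → |f x - f y| ≤ K * (y - x)) : LipschitzOnWith K f s := by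
  refine LipschitzOnWith.of_dist_le_mul fun x hx y hy => ?_
  rcases le_total x y with hxy | hyx
  · rw [Real.dist_eq, dist_comm x, Real.dist_eq, abs_of_nonneg (sub_nonneg.2 hxy)]
    exact h x hx y hy hxy
  · rw [dist_comm, Real.dist_eq, Real.dist_eq, abs_of_nonneg (sub_nonneg.2 hyx)]
    exact h y hy x hx hyx

end Variation

section Weights

theorem edist_le_ofReal_abs_w (U V : State) :
    edist U V ≤ ENNReal.ofReal (|w₁ V - w₁ U| + |w₂ V - w₂ U|) := by
  rw [edist_dist, Prod.dist_eq, Real.dist_eq, Real.dist_eq]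
  refine ENNReal.ofReal_le_ofReal (max_le ?_ ?_) <;>
  · simp only [w₁, w₂]
    grind

theorem abs_w₁_sub_le (U V : State) : |w₁ V - w₁ U| ≤ 2 * dist U V := by
  rw [Prod.dist_eq, Real.dist_eq, Real.dist_eq]
  simp only [w₁]
  grind

theorem abs_w₂_sub_le (U V : State) : |w₂ V - w₂ U| ≤ 2 * dist U V := by
  rw [Prod.dist_eq, Real.dist_eq, Real.dist_eq]
  simp only [w₂]
  grind

theorem IsWeight.exists_bounds {W : State × State → ℝ} (hW : IsWeight W) {K : Set State}
    (hK : IsCompact K) (hpos : ∀ U ∈ K, 0 < U.2) :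
    ∃ m C, 0 < m ∧ 0 ≤ C ∧ ∀ U ∈ K, ∀ V ∈ K, m ≤ W (U, V) ∧ W (U, V) ≤ C := by
  have hcont : ContinuousOn W (K ×ˢ K) := hW.1.mono fun p hp => ⟨hpos _ hp.1, hpos _ hp.2⟩
  obtain ⟨m, hm, hmW⟩ := (hK.prod hK).exists_forall_le' hcont
    fun p hp => hW.2 p (hpos _ hp.1) (hpos _ hp.2)
  obtain ⟨C, hC⟩ := (hK.prod hK).bddAbove_image hcont
  exact ⟨m, max C 0, hm, le_max_right _ _, fun U hU V hV => ⟨hmW (U, V) ⟨hU, hV⟩,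
    le_max_of_le_left (hC (mem_image_of_mem W (mk_mem_prod hU hV)))⟩⟩

variable {W₁ W₂ : State × State → ℝ} {V : ℝ → State}

theorem weightedSum_le {C : ℝ} (hC : 0 ≤ C) : ∀ l : List ℝ, l.Pairwise (· ≤ ·) →
    (∀ x ∈ l, ∀ y ∈ l, W₁ (V x, V y) ≤ C ∧ W₂ (V x, V y) ≤ C) →
    weightedSum W₁ W₂ V l ≤ ENNReal.ofReal (4 * C) * eVariationOn V {z | z ∈ l}
  | [], _, _ => by simp [weightedSum]
  | [x], _, _ => by simp [weightedSum]
  | x :: y :: l, hl, h => by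
    obtain ⟨h₁, h₂⟩ := h x (by simp) y (by simp)
    have hxy : ENNReal.ofReal (W₁ (V x, V y) * |w₁ (V y) - w₁ (V x)| +
        W₂ (V x, V y) * |w₂ (V y) - w₂ (V x)|) ≤
        ENNReal.ofReal (4 * C) * edist (V x) (V y) := by
      rw [edist_dist, ← ENNReal.ofReal_mul (by positivity)]
      refine ENNReal.ofReal_le_ofReal ?_
      calc _ ≤ C * (2 * dist (V x) (V y)) + C * (2 * dist (V x) (V y)) := by
            gcongr
            exacts [abs_w₁_sub_le _ _, abs_w₂_sub_le _ _]
        _ = _ := by ring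
    rw [weightedSum, eVariationOn_mem_cons_cons V hl, mul_add]
    exact add_le_add hxy (weightedSum_le hC (y :: l) hl.of_cons fun a ha b hb =>
      h a (List.mem_cons_of_mem _ ha) b (List.mem_cons_of_mem _ hb))

theorem le_weightedSum {m : ℝ} (hm : 0 ≤ m) : ∀ l : List ℝ, l.Pairwise (· ≤ ·) →
    (∀ x ∈ l, ∀ y ∈ l, m ≤ W₁ (V x, V y) ∧ m ≤ W₂ (V x, V y)) →
    ENNReal.ofReal m * eVariationOn V {z | z ∈ l} ≤ weightedSum W₁ W₂ V l
  | [], _, _ => by simp [weightedSum]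
  | [x], _, _ => by simp [weightedSum]
  | x :: y :: l, hl, h => by
    obtain ⟨h₁, h₂⟩ := h x (by simp) y (by simp)
    have hxy : ENNReal.ofReal m * edist (V x) (V y) ≤
        ENNReal.ofReal (W₁ (V x, V y) * |w₁ (V y) - w₁ (V x)| +
          W₂ (V x, V y) * |w₂ (V y) - w₂ (V x)|) := by
      calc ENNReal.ofReal m * edist (V x) (V y)
          ≤ ENNReal.ofReal (m * (|w₁ (V y) - w₁ (V x)| + |w₂ (V y) - w₂ (V x)|)) := by
            rw [ENNReal.ofReal_mul hm]
            exact mul_le_mul_right (edist_le_ofReal_abs_w _ _) _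
        _ ≤ _ := by
            rw [mul_add]
            gcongr
    rw [weightedSum, eVariationOn_mem_cons_cons V hl, mul_add]
    exact add_le_add hxy (le_weightedSum hm (y :: l) hl.of_cons fun a ha b hb =>
      h a (List.mem_cons_of_mem _ ha) b (List.mem_cons_of_mem _ hb))

/-- The increasing list of points along which `weightedVariation` evaluates the profile. As there,
Lean coerces the sorted list to `List ℝ` by a monadic lift and only then applies `map`. -/
noncomputable def sortedPoints {S : Set ℝ} (T : Finset S) : List ℝ :=
  (T.sort (· ≤ ·)).map (fun x => (x : ℝ))

theorem sortedPoints_eq_map_val {S : Set ℝ} (T : Finset S) :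
    sortedPoints T = (T.sort (· ≤ ·)).map Subtype.val := by
  simp only [sortedPoints, List.map_id', List.bind_eq_flatMap, List.pure_def]
  exact List.map_eq_flatMap.symm

theorem pairwise_sortedPoints {S : Set ℝ} (T : Finset S) :
    (sortedPoints T).Pairwise (· ≤ ·) := by
  rw [sortedPoints_eq_map_val]
  exact List.pairwise_map.2 ((T.pairwise_sort (· ≤ ·)).imp fun h => h)

theorem setOf_mem_sortedPoints {S : Set ℝ} (T : Finset S) :
    {z | z ∈ sortedPoints T} = Subtype.val '' (T : Set S) := by
  ext z
  simp [sortedPoints_eq_map_val]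

theorem weightedVariation_lt_top_iff (h₁ : IsWeight W₁) (h₂ : IsWeight W₂) {K : Set State}
    (hK : IsCompact K) (hpos : ∀ U ∈ K, 0 < U.2) {S : Set ℝ} (hV : MapsTo V S K) :
    weightedVariation W₁ W₂ V S < ⊤ ↔ BoundedVariationOn V S := by
  obtain ⟨m₁, C₁, hm₁, hC₁, hW₁⟩ := h₁.exists_bounds hK hpos
  obtain ⟨m₂, C₂, hm₂, -, hW₂⟩ := h₂.exists_bounds hK hpos
  have hmem : ∀ (T : Finset S), ∀ x ∈ sortedPoints T, V x ∈ K := fun T x hx =>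
    hV (Subtype.coe_image_subset S T (setOf_mem_sortedPoints T ▸ hx))
  have hscaled (a : ℝ) : limsup (fun T : Finset S => ENNReal.ofReal a *
      eVariationOn V {z | z ∈ sortedPoints T}) atTop = ENNReal.ofReal a * eVariationOn V S := by
    simp only [setOf_mem_sortedPoints]
    exact (ENNReal.Tendsto.const_mul (tendsto_eVariationOn_finset V S)
      (Or.inr ENNReal.ofReal_ne_top)).limsup_eq
  have hlower : ENNReal.ofReal (min m₁ m₂) * eVariationOn V S ≤ weightedVariation W₁ W₂ V S := by
    rw [← hscaled]
    refine limsup_le_limsup (Eventually.of_forall fun T => ?_)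
    refine le_weightedSum (lt_min hm₁ hm₂).le _ (pairwise_sortedPoints T) fun x hx y hy => ?_
    exact ⟨min_le_of_left_le (hW₁ _ (hmem T x hx) _ (hmem T y hy)).1,
      min_le_of_right_le (hW₂ _ (hmem T x hx) _ (hmem T y hy)).1⟩
  have hupper : weightedVariation W₁ W₂ V S ≤
      ENNReal.ofReal (4 * max C₁ C₂) * eVariationOn V S := by
    rw [← hscaled]
    refine limsup_le_limsup (Eventually.of_forall fun T => ?_)
    refine weightedSum_le (le_max_of_le_left hC₁) _ (pairwise_sortedPoints T) fun x hx y hy => ?_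
    exact ⟨le_max_of_le_left (hW₁ _ (hmem T x hx) _ (hmem T y hy)).2,
      le_max_of_le_right (hW₂ _ (hmem T x hx) _ (hmem T y hy)).2⟩
  refine ⟨fun h hV => ?_, fun h => hupper.trans_lt
    (ENNReal.mul_lt_top ENNReal.ofReal_lt_top h.lt_top)⟩
  rw [hV, ENNReal.mul_top (by simp [hm₁, hm₂])] at hlower
  exact h.not_ge hlower

end Weights

section ShockCurve

theorem wave₁_of_hugoniot {U V : State} (hU : 0 < U.2) (hUV : U.2 < V.2) (hu : V.1 < U.1)
    (h : 3 * (U.2 * V.2) * (U.1 - V.1) ^ 2 = (V.2 - U.2) * (V.2 ^ 3 - U.2 ^ 3)) : Wave₁ U V := by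
  have hV : 0 < V.2 := hU.trans hUV
  have hd : V.2 - U.2 ≠ 0 := (sub_pos.2 hUV).ne'
  refine ⟨hU, hV, Or.inr ⟨hUV, -((U.1 - V.1) * (U.2 * V.2) / (V.2 - U.2)), ?_, ?_, ?_⟩⟩
  · exact neg_neg_of_pos (div_pos (mul_pos (sub_pos.2 hu) (mul_pos hU hV)) (sub_pos.2 hUV))
  · field_simp
    ring
  · field_simp
    linear_combination h

/-- The density on the right of the 1-shock across which `w₁` jumps from `0` to `1` and which has
density ratio `s ^ 2`; it is of order `s` for weak densities. -/
noncomputable def shockRight (s : ℝ) : ℝ := s / ((1 - s ^ 2) * (s + √((1 + s ^ 2 + s ^ 4) / 3)))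

/-- The density on the left of the 1-shock across which `w₁` jumps from `0` to `1` and which has
density ratio `s ^ 2`; it is of order `s ^ 3` for weak densities. -/
noncomputable def shockLeft (s : ℝ) : ℝ := s ^ 2 * shockRight s

theorem wave₁_shock {s : ℝ} (h0 : 0 < s) (h1 : s < 1) :
    Wave₁ (shockLeft s, shockLeft s) (shockRight s - 1, shockRight s) := by
  unfold shockLeft
  set B := shockRight s
  set Q := √((1 + s ^ 2 + s ^ 4) / 3)
  have hQ_sq : Q ^ 2 = (1 + s ^ 2 + s ^ 4) / 3 := Real.sq_sqrt (by positivity)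
  have : 0 < Q := Real.sqrt_pos.2 (by positivity)
  have hs : 0 < 1 - s ^ 2 := by nlinarith
  have hD : 0 < (1 - s ^ 2) * (s + Q) := by positivity
  have hB_pos : 0 < B := div_pos h0 hD
  have hB_mul : B * ((1 - s ^ 2) * (s + Q)) = s := div_mul_cancel₀ _ hD.ne'
  have hjump : (s ^ 2 * B - (B - 1)) * s = B * (1 - s ^ 2) * Q := by linear_combination -hB_mul
  have hjump_pos : 0 < s ^ 2 * B - (B - 1) :=
    pos_of_mul_pos_left (hjump ▸ by positivity) h0.le
  refine wave₁_of_hugoniot (mul_pos (pow_pos h0 2) hB_pos) ?_ (sub_pos.1 hjump_pos) ?_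
  · exact mul_lt_of_lt_one_left hB_pos (by linarith)
  · calc 3 * (s ^ 2 * B * B) * (s ^ 2 * B - (B - 1)) ^ 2
        = 3 * B ^ 2 * ((s ^ 2 * B - (B - 1)) * s) ^ 2 := by ring
      _ = 3 * B ^ 4 * (1 - s ^ 2) ^ 2 * Q ^ 2 := by rw [hjump]; ring
      _ = (B - s ^ 2 * B) * (B ^ 3 - (s ^ 2 * B) ^ 3) := by rw [hQ_sq]; ring

theorem shockRight_denom_mem {s : ℝ} (h : s ∈ Icc (0 : ℝ) (1 / 2)) :
    (1 - s ^ 2) * (s + √((1 + s ^ 2 + s ^ 4) / 3)) ∈ Icc (2 / 5 : ℝ) (5 / 4) := by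
  obtain ⟨h0, h1⟩ := h
  have h2 : s ^ 2 ≤ 1 / 4 := by nlinarith
  have h4 : s ^ 4 ≤ 1 / 16 := by nlinarith
  have hlower : 8 / 15 ≤ √((1 + s ^ 2 + s ^ 4) / 3) :=
    Real.le_sqrt_of_sq_le (by nlinarith [sq_nonneg (s ^ 2)])
  have hupper : √((1 + s ^ 2 + s ^ 4) / 3) ≤ 3 / 4 :=
    Real.sqrt_le_iff.2 ⟨by norm_num, by linarith⟩
  constructor <;> nlinarith

theorem le_shockRight {s : ℝ} (h : s ∈ Icc (0 : ℝ) (1 / 2)) : 4 / 5 * s ≤ shockRight s := by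
  obtain ⟨h1, h2⟩ := shockRight_denom_mem h
  rw [shockRight, le_div_iff₀ (by linarith)]
  nlinarith [h.1]

theorem shockRight_le {s : ℝ} (h : s ∈ Icc (0 : ℝ) (1 / 2)) : shockRight s ≤ 5 / 2 * s := by
  obtain ⟨h1, -⟩ := shockRight_denom_mem h
  rw [shockRight, div_le_iff₀ (by linarith)]
  nlinarith [h.1]

theorem exists_lipschitzOnWith_shockRight : ∃ K, LipschitzOnWith K shockRight (Icc 0 (1 / 2)) := by
  refine ContDiffOn.exists_lipschitzOnWith (n := 1) ?_ one_ne_zero (convex_Icc _ _) isCompact_Icc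
  unfold shockRight
  refine contDiffOn_id.div ?_ fun s hs => by linarith [(shockRight_denom_mem hs).1]
  refine ContDiffOn.mul (by fun_prop) (contDiffOn_id.add (ContDiffOn.sqrt (by fun_prop) ?_))
  intro s _
  positivity

theorem exists_abs_shockLeft_sub_le : ∃ K : NNReal, ∀ s ∈ Icc (0 : ℝ) (1 / 2),
    ∀ t ∈ Icc (0 : ℝ) (1 / 2), |shockLeft s - shockLeft t| ≤ K * (max s t * |s - t|) := by
  obtain ⟨K, hK⟩ := exists_lipschitzOnWith_shockRight
  refine ⟨K + 5 / 2, fun s hs t ht => ?_⟩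
  have hB : |shockRight s - shockRight t| ≤ K * |s - t| := hK.dist_le_mul s hs t ht
  have hBs : 0 ≤ shockRight s := by linarith [le_shockRight hs, hs.1]
  have hB_le : (s + t) * shockRight s ≤ max s t * (5 / 2) := by
    nlinarith [shockRight_le hs, hs.2, hs.1, ht.1, le_max_left s t, le_max_right s t]
  have ht_sq : t ^ 2 ≤ max s t := by nlinarith [ht.1, ht.2, le_max_right s t]
  have hst : 0 ≤ s + t := add_nonneg hs.1 ht.1
  have hmax : 0 ≤ max s t := le_max_of_le_left hs.1
  calc |shockLeft s - shockLeft t|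
      = |(s - t) * ((s + t) * shockRight s) + t ^ 2 * (shockRight s - shockRight t)| := by
        simp only [shockLeft]
        ring_nf
    _ ≤ |s - t| * ((s + t) * shockRight s) + t ^ 2 * |shockRight s - shockRight t| := by
        refine (abs_add_le _ _).trans_eq ?_
        rw [abs_mul, abs_mul (t ^ 2), abs_of_nonneg (mul_nonneg hst hBs),
          abs_of_nonneg (sq_nonneg t)]
    _ ≤ |s - t| * (max s t * (5 / 2)) + max s t * (K * |s - t|) := by gcongr
    _ = (K + 5 / 2 : NNReal) * (max s t * |s - t|) := by push_cast; ring

end ShockCurve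

section Oscillation

/-- An oscillation of infinite total variation near `0`, whose amplitude and whose distance from
`0` are both comparable with `e`. -/
noncomputable def osc (e : ℝ) : ℝ := e * (5 + 3 * Real.sin e⁻¹) / 16

theorem continuous_osc : Continuous osc := by
  refine continuous_iff_continuousAt.2 fun e => ?_
  rcases eq_or_ne e 0 with rfl | he
  · have hbound : ∀ e : ℝ, ‖osc e‖ ≤ |e| := fun e => by
      rw [osc, Real.norm_eq_abs, mul_div_assoc, abs_mul]
      refine mul_le_of_le_one_right (abs_nonneg e) (abs_le.2 ?_)
      constructor <;> linarith [Real.neg_one_le_sin e⁻¹, Real.sin_le_one e⁻¹]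
    rw [ContinuousAt, show osc 0 = 0 by simp [osc]]
    exact squeeze_zero_norm hbound (by simpa using continuous_abs.tendsto (0 : ℝ))
  · unfold osc
    fun_prop (disch := assumption)

theorem le_osc {e : ℝ} (h : 0 ≤ e) : e / 8 ≤ osc e := by
  unfold osc
  nlinarith [Real.neg_one_le_sin e⁻¹]

theorem osc_le {e : ℝ} (h : 0 ≤ e) : osc e ≤ e / 2 := by
  unfold osc
  nlinarith [Real.sin_le_one e⁻¹]

theorem osc_mem_Icc {e : ℝ} (h : e ∈ Icc (0 : ℝ) 1) : osc e ∈ Icc (0 : ℝ) (1 / 2) :=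
  ⟨by linarith [le_osc h.1, h.1], by linarith [osc_le h.1, h.2]⟩

theorem abs_mul_sin_inv_sub_le {e f : ℝ} (he : 0 < e) (hef : e ≤ f) :
    |f * e * (Real.sin e⁻¹ - Real.sin f⁻¹)| ≤ f - e := by
  have hf : 0 < f := he.trans_le hef
  have hinv : |e⁻¹ - f⁻¹| = (f - e) / (f * e) := by
    rw [inv_sub_inv he.ne' hf.ne', mul_comm e f,
      abs_of_nonneg (div_nonneg (sub_nonneg.2 hef) (by positivity))]
  rw [abs_mul, abs_of_pos (mul_pos hf he)]
  calc f * e * |Real.sin e⁻¹ - Real.sin f⁻¹| ≤ f * e * ((f - e) / (f * e)) := by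
        gcongr
        rw [← hinv]
        exact Real.lipschitzWith_sin.dist_le_mul e⁻¹ f⁻¹ |>.trans_eq (by simp [Real.dist_eq])
    _ = f - e := by field_simp

theorem abs_osc_sub_mul_le {e f : ℝ} (he : 0 ≤ e) (hef : e ≤ f) (hf : f ≤ 1) :
    |osc e - osc f| * f ≤ f - e := by
  rcases he.eq_or_lt with rfl | he
  · have hf0 : 0 ≤ osc f := by linarith [le_osc hef]
    rw [show osc 0 = 0 by simp [osc], zero_sub, abs_neg, abs_of_nonneg hf0]
    nlinarith [osc_le hef]
  have hf0 : 0 < f := he.trans_le hef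
  have hsin := abs_le.1 (abs_mul_sin_inv_sub_le he hef)
  have hdecomp : (osc e - osc f) * f = 3 / 16 * (f * e * (Real.sin e⁻¹ - Real.sin f⁻¹)) -
      (5 + 3 * Real.sin f⁻¹) / 16 * (f * (f - e)) := by
    simp only [osc]
    ring
  have hprod : 0 ≤ f * (f - e) := mul_nonneg hf0.le (sub_nonneg.2 hef)
  have hprod_le : f * (f - e) ≤ f - e := mul_le_of_le_one_left (sub_nonneg.2 hef) hf
  rw [← abs_of_pos hf0, ← abs_mul, abs_of_pos hf0, hdecomp, abs_le]
  constructor <;> nlinarith [Real.neg_one_le_sin f⁻¹, Real.sin_le_one f⁻¹]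

theorem exists_lipschitzOnWith_osc {η : ℝ} (hη : 0 < η) : ∃ K, LipschitzOnWith K osc (Icc η 1) := by
  refine ⟨⟨η⁻¹, by positivity⟩, lipschitzOnWith_of_le fun e he f hf hef => ?_⟩
  have h := abs_osc_sub_mul_le (hη.le.trans he.1) hef hf.2
  change |osc e - osc f| ≤ η⁻¹ * (f - e)
  rw [inv_mul_eq_div, le_div_iff₀ hη]
  exact (mul_le_mul_of_nonneg_left hf.1 (abs_nonneg _)).trans h

/- The increments of `osc` are of order `de / e`; those of `shockLeft` carry a factor `e`. -/
theorem exists_lipschitzOnWith_shockLeft_osc :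
    ∃ K, LipschitzOnWith K (fun e => shockLeft (osc e)) (Icc 0 1) := by
  obtain ⟨K, hK⟩ := exists_abs_shockLeft_sub_le
  refine ⟨K, lipschitzOnWith_of_le fun e he f hf hef => ?_⟩
  have hmax : max (osc e) (osc f) ≤ f :=
    max_le (by linarith [osc_le he.1, hf.1]) (by linarith [osc_le hf.1, hf.1])
  calc |shockLeft (osc e) - shockLeft (osc f)|
      ≤ K * (max (osc e) (osc f) * |osc e - osc f|) :=
        hK _ (osc_mem_Icc he) _ (osc_mem_Icc hf)
    _ ≤ K * (f - e) := by
        gcongr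
        rw [mul_comm]
        exact (mul_le_mul_of_nonneg_left hmax (abs_nonneg _)).trans
          (abs_osc_sub_mul_le he.1 hef hf.2)

/-- The points where `osc` alternately touches the lines `e / 2` and `e / 8`. -/
noncomputable def oscPoint (k : ℕ) : ℝ := (Real.pi / 2 + k * Real.pi)⁻¹

theorem oscPoint_pos (k : ℕ) : 0 < oscPoint k :=
  inv_pos.2 (by positivity)

theorem antitone_oscPoint : Antitone oscPoint := fun k l h => by
  unfold oscPoint
  gcongr

theorem oscPoint_le_one (k : ℕ) : oscPoint k ≤ 1 := by
  refine (antitone_oscPoint k.zero_le).trans (inv_le_one_of_one_le₀ ?_)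
  simp [Real.one_le_pi_div_two]

theorem osc_oscPoint (k : ℕ) : osc (oscPoint k) = oscPoint k * (5 + 3 * (-1) ^ k) / 16 := by
  rw [osc, oscPoint, inv_inv, Real.sin_add_nat_mul_pi, Real.sin_pi_div_two, mul_one]

theorem osc_oscPoint_even (n : ℕ) : osc (oscPoint (2 * n)) = oscPoint (2 * n) / 2 := by
  rw [osc_oscPoint, (even_two_mul n).neg_one_pow]
  ring

theorem osc_oscPoint_odd (n : ℕ) : osc (oscPoint (2 * n + 1)) = oscPoint (2 * n + 1) / 8 := by
  rw [osc_oscPoint, (odd_two_mul_add_one n).neg_one_pow]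
  ring

theorem one_div_le_oscPoint (n : ℕ) : 1 / (8 * (n + 1 : ℝ)) ≤ oscPoint (2 * n) := by
  rw [oscPoint, ← one_div]
  refine one_div_le_one_div_of_le (by positivity) ?_
  push_cast
  nlinarith [Real.pi_le_four, Real.pi_pos]

theorem one_div_le_shockRight_osc_sub (n : ℕ) :
    1 / (100 * (n + 1 : ℝ)) ≤ shockRight (osc (oscPoint (2 * n))) -
      shockRight (osc (oscPoint (2 * n + 1))) := by
  have hmem (k : ℕ) : osc (oscPoint k) ∈ Icc (0 : ℝ) (1 / 2) :=
    osc_mem_Icc ⟨(oscPoint_pos k).le, oscPoint_le_one k⟩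
  have heven := le_shockRight (hmem (2 * n))
  have hodd := shockRight_le (hmem (2 * n + 1))
  rw [osc_oscPoint_even] at heven ⊢
  rw [osc_oscPoint_odd] at hodd ⊢
  have hstep : oscPoint (2 * n + 1) ≤ oscPoint (2 * n) := antitone_oscPoint (2 * n).le_succ
  have hpoint := one_div_le_oscPoint n
  have hscale : 1 / (100 * (n + 1 : ℝ)) = 2 / 25 * (1 / (8 * (n + 1))) := by
    field_simp
    norm_num
  linarith [oscPoint_pos (2 * n)]

end Oscillation

section Densities

/-- The label of a wave truncated to `[-1, 1]`, so that the profiles are constant far away. -/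
noncomputable def trunc (x : ℝ) : ℝ := max (-1) (min 1 x)

theorem continuous_trunc : Continuous trunc := by
  unfold trunc
  fun_prop

theorem monotone_trunc : Monotone trunc :=
  monotone_const.max (monotone_const.min monotone_id)

theorem trunc_mem_Icc (x : ℝ) : trunc x ∈ Icc (-1 : ℝ) 1 :=
  ⟨le_max_left _ _, max_le (by norm_num) (min_le_left _ _)⟩

theorem trunc_of_mem_Icc {x : ℝ} (h : x ∈ Icc (-1 : ℝ) 1) : trunc x = x := by
  rw [trunc, min_eq_right h.2, max_eq_right h.1]

theorem boundedVariationOn_trunc (s : Set ℝ) : BoundedVariationOn trunc s :=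
  (monotone_trunc.monotoneOn s).boundedVariationOn (C := 1) fun x _ =>
    abs_le.2 (trunc_mem_Icc x)

theorem abs_trunc_mem_Icc (x : ℝ) : |trunc x| ∈ Icc (0 : ℝ) 1 :=
  ⟨abs_nonneg _, abs_le.2 (trunc_mem_Icc x)⟩

theorem boundedVariationOn_abs_trunc (s : Set ℝ) : BoundedVariationOn (fun x => |trunc x|) s := by
  simpa only [Function.comp_def, Real.norm_eq_abs] using
    (lipschitzWith_one_norm (E := ℝ)).comp_boundedVariationOn (boundedVariationOn_trunc s)

/-- The parameter `s` of the shock when it meets the 2-wave with label `q`. -/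
noncomputable def shockParam (q : ℝ) : ℝ := osc |trunc q|

/-- The density on the left of the shock when it meets the 2-wave with label `q`. -/
noncomputable def leftDensity (q : ℝ) : ℝ := shockLeft (shockParam q)

/-- The density on the right of the shock when it meets the 2-wave with label `q`. -/
noncomputable def rightDensity (q : ℝ) : ℝ := shockRight (shockParam q)

theorem shockParam_mem_Icc (q : ℝ) : shockParam q ∈ Icc (0 : ℝ) (1 / 2) :=
  osc_mem_Icc (abs_trunc_mem_Icc q)

theorem shockParam_pos {q : ℝ} (h : q ≠ 0) : 0 < shockParam q := by
  have htrunc : trunc q ≠ 0 := by grind [trunc]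
  linarith [le_osc (abs_nonneg (trunc q)), abs_pos.2 htrunc,
    show shockParam q = osc |trunc q| from rfl]

theorem rightDensity_mem_Icc (q : ℝ) : rightDensity q ∈ Icc (0 : ℝ) (5 / 4) := by
  have h := shockParam_mem_Icc q
  constructor <;> unfold rightDensity <;> linarith [le_shockRight h, shockRight_le h, h.1, h.2]

theorem rightDensity_pos {q : ℝ} (h : q ≠ 0) : 0 < rightDensity q := by
  unfold rightDensity
  linarith [le_shockRight (shockParam_mem_Icc q), shockParam_pos h]

theorem leftDensity_mem_Icc (q : ℝ) : leftDensity q ∈ Icc (0 : ℝ) 1 := by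
  obtain ⟨hB₀, hB⟩ := rightDensity_mem_Icc q
  obtain ⟨hs₀, hs⟩ := shockParam_mem_Icc q
  change shockParam q ^ 2 * rightDensity q ∈ _
  exact ⟨by positivity, by nlinarith⟩

theorem le_shockParam {q : ℝ} (h : 1 / 2 ≤ q) : 1 / 16 ≤ shockParam q := by
  have htrunc : 1 / 2 ≤ |trunc q| :=
    (le_max_of_le_right (le_min (by norm_num) h)).trans (le_abs_self (trunc q))
  unfold shockParam
  linarith [le_osc (abs_nonneg (trunc q))]

theorem le_rightDensity {q : ℝ} (h : 1 / 2 ≤ q) : 1 / 20 ≤ rightDensity q := by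
  unfold rightDensity
  linarith [le_shockRight (shockParam_mem_Icc q), le_shockParam h]

theorem le_leftDensity {q : ℝ} (h : 1 / 2 ≤ q) : 1 / 5120 ≤ leftDensity q := by
  change _ ≤ shockParam q ^ 2 * rightDensity q
  nlinarith [le_rightDensity h, le_shockParam h]

theorem continuous_rightDensity : Continuous rightDensity := by
  obtain ⟨K, hK⟩ := exists_lipschitzOnWith_shockRight
  exact hK.continuousOn.comp_continuous (continuous_osc.comp continuous_trunc.abs)
    shockParam_mem_Icc

theorem continuous_leftDensity : Continuous leftDensity :=
  ((continuous_osc.comp continuous_trunc.abs).pow 2).mul continuous_rightDensity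

theorem boundedVariationOn_leftDensity : BoundedVariationOn leftDensity univ := by
  obtain ⟨K, hK⟩ := exists_lipschitzOnWith_shockLeft_osc
  exact hK.comp_boundedVariationOn (fun q _ => abs_trunc_mem_Icc q)
    (boundedVariationOn_abs_trunc univ)

theorem boundedVariationOn_rightDensity {η : ℝ} (hη : 0 < η) :
    BoundedVariationOn rightDensity (Ici η) := by
  obtain ⟨L, hL⟩ := exists_lipschitzOnWith_shockRight
  obtain ⟨K, hK⟩ := exists_lipschitzOnWith_osc (lt_min hη one_pos)
  refine hL.comp_boundedVariationOn (fun q _ => shockParam_mem_Icc q)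
    (hK.comp_boundedVariationOn (fun q hq => ⟨?_, (abs_trunc_mem_Icc q).2⟩)
      (boundedVariationOn_abs_trunc (Ici η)))
  rw [min_comm]
  exact (min_le_min_left 1 hq).trans ((le_max_right _ _).trans (le_abs_self (trunc q)))

theorem rightDensity_oscPoint (k : ℕ) :
    rightDensity (oscPoint k) = shockRight (osc (oscPoint k)) := by
  have h := oscPoint_pos k
  rw [rightDensity, shockParam, trunc_of_mem_Icc ⟨by linarith, oscPoint_le_one k⟩, abs_of_pos h]

theorem ofReal_le_edist_rightDensity_oscPoint (n : ℕ) :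
    ENNReal.ofReal (1 / (100 * (n + 1 : ℝ))) ≤
      edist (rightDensity (oscPoint (2 * n + 1))) (rightDensity (oscPoint (2 * n))) := by
  rw [edist_comm, edist_dist, Real.dist_eq, rightDensity_oscPoint, rightDensity_oscPoint]
  exact ENNReal.ofReal_le_ofReal ((one_div_le_shockRight_osc_sub n).trans (le_abs_self _))

theorem tsum_ofReal_one_div_eq_top :
    ∑' n : ℕ, ENNReal.ofReal (1 / (100 * (n + 1 : ℝ))) = ⊤ := by
  by_contra h
  have hsummable : Summable fun n : ℕ => 1 / (100 * (n + 1 : ℝ)) := by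
    refine (ENNReal.summable_toReal h).congr fun n => ENNReal.toReal_ofReal (by positivity)
  refine Real.not_summable_one_div_natCast ((summable_nat_add_iff 1).1 ?_)
  refine (hsummable.mul_left 100).congr fun n => ?_
  push_cast
  field_simp

theorem eVariationOn_rightDensity_Ioi : eVariationOn rightDensity (Ioi 0) = ⊤ := by
  refine top_unique ?_
  calc ⊤ = ∑' n : ℕ, ENNReal.ofReal (1 / (100 * (n + 1 : ℝ))) := tsum_ofReal_one_div_eq_top.symm
    _ ≤ ∑' n, edist (rightDensity (oscPoint (2 * n + 1))) (rightDensity (oscPoint (2 * n))) :=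
        ENNReal.tsum_le_tsum ofReal_le_edist_rightDensity_oscPoint
    _ ≤ eVariationOn (rightDensity ∘ oscPoint) univ := tsum_edist_le_eVariationOn _
    _ ≤ eVariationOn rightDensity (Ioi 0) :=
        eVariationOn.comp_le_of_antitoneOn _ _ (antitone_oscPoint.antitoneOn univ)
          fun k _ => oscPoint_pos k

end Densities

section RiemannInvariants

/-- The state with Riemann invariants `w₁ = a` and `w₂ = b`. -/
noncomputable def ofInvariants (a b : ℝ) : State := ((b - a) / 2, (a + b) / 2)

theorem w₁_ofInvariants (a b : ℝ) : w₁ (ofInvariants a b) = a := by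
  simp only [w₁, ofInvariants]
  ring

theorem w₂_ofInvariants (a b : ℝ) : w₂ (ofInvariants a b) = b := by
  simp only [w₂, ofInvariants]
  ring

theorem ofInvariants_w (U : State) : ofInvariants (w₁ U) (w₂ U) = U := by
  simp only [ofInvariants, w₁, w₂]
  ext <;> simp only <;> ring

theorem lipschitzWith_ofInvariants : LipschitzWith 1 fun z : ℝ × ℝ => ofInvariants z.1 z.2 := by
  refine LipschitzWith.of_dist_le_mul fun z z' => ?_
  simp only [ofInvariants, Prod.dist_eq, Real.dist_eq, NNReal.coe_one]
  grind

theorem continuous_ofInvariants : Continuous fun z : ℝ × ℝ => ofInvariants z.1 z.2 :=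
  lipschitzWith_ofInvariants.continuous

theorem riemannMiddle_of_wave₁ {U V : State} (h : Wave₁ U V) : RiemannMiddle U V V :=
  ⟨h, h.2.1, h.2.1, Or.inl ⟨rfl, le_rfl⟩⟩

theorem riemannMiddle_self {U : State} (h : 0 < U.2) : RiemannMiddle U U U :=
  riemannMiddle_of_wave₁ ⟨h, h, Or.inl ⟨rfl, le_rfl⟩⟩

end RiemannInvariants

/-- Data for a flow with continuous waves of both families and a single jump, a 1-front. The
1-waves are labelled by `p = x + c t`, the jump being at `p = front`, and the 2-waves by
`q = x - c t`; the values of `w₁` and `w₂` carried by the waves are prescribed separately on the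
left and on the right of the front. -/
structure SingleShock where
  front : ℝ
  left₁ : ℝ → ℝ
  right₁ : ℝ → ℝ
  left₂ : ℝ → ℝ
  right₂ : ℝ → ℝ
  continuous_left₁ : Continuous left₁
  continuous_right₁ : Continuous right₁
  continuous_left₂ : Continuous left₂
  continuous_right₂ : Continuous right₂
  left_nonneg : ∀ p < front, ∀ q, 0 ≤ left₁ p + left₂ q
  right_nonneg : ∀ p ≥ front, ∀ q, 0 ≤ right₁ p + right₂ q
  wave₁ : ∀ q, 0 < right₁ front + right₂ q →
    Wave₁ (ofInvariants (left₁ front) (left₂ q)) (ofInvariants (right₁ front) (right₂ q))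

namespace SingleShock

variable (S : SingleShock) {c t x : ℝ}

/-- The state where the 1-wave `p`, coming from the left of the front, meets the 2-wave `q`. -/
noncomputable def leftState (p q : ℝ) : State := ofInvariants (S.left₁ p) (S.left₂ q)

/-- The state where the 1-wave `p`, coming from the right of the front, meets the 2-wave `q`. -/
noncomputable def rightState (p q : ℝ) : State := ofInvariants (S.right₁ p) (S.right₂ q)

/-- The state where the 1-wave `p` meets the 2-wave `q`. -/
noncomputable def state (p q : ℝ) : State :=
  if p < S.front then S.leftState p q else S.rightState p q

/-- The flow in which all the waves travel with speeds `-c` and `c`. -/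
noncomputable def flow (c t x : ℝ) : State := S.state (x + c * t) (x - c * t)

theorem state_of_lt {p : ℝ} (h : p < S.front) (q : ℝ) : S.state p q = S.leftState p q := if_pos h

theorem state_of_le {p : ℝ} (h : S.front ≤ p) (q : ℝ) : S.state p q = S.rightState p q :=
  if_neg h.not_gt

theorem flow_zero : S.flow c 0 x = S.state x x := by
  rw [flow, mul_zero, add_zero, sub_zero]

theorem w₁_flow : w₁ (S.flow c t x) =
    if x + c * t < S.front then S.left₁ (x + c * t) else S.right₁ (x + c * t) := by
  rw [flow, state, apply_ite w₁, leftState, rightState, w₁_ofInvariants, w₁_ofInvariants]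

theorem w₂_flow : w₂ (S.flow c t x) =
    if x + c * t < S.front then S.left₂ (x - c * t) else S.right₂ (x - c * t) := by
  rw [flow, state, apply_ite w₂, leftState, rightState, w₂_ofInvariants, w₂_ofInvariants]

theorem density_flow_nonneg : 0 ≤ (S.flow c t x).2 := by
  rw [← ofInvariants_w (S.flow c t x), w₁_flow, w₂_flow]
  refine div_nonneg ?_ zero_le_two
  split_ifs with h
  exacts [S.left_nonneg _ h _, S.right_nonneg _ (not_lt.1 h) _]

section Continuity

theorem continuous_leftState_flow :
    Continuous fun z : ℝ × ℝ => S.leftState (z.2 + c * z.1) (z.2 - c * z.1) :=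
  continuous_ofInvariants.comp ((S.continuous_left₁.comp (by fun_prop)).prodMk
    (S.continuous_left₂.comp (by fun_prop)))

theorem continuous_rightState_flow :
    Continuous fun z : ℝ × ℝ => S.rightState (z.2 + c * z.1) (z.2 - c * z.1) :=
  continuous_ofInvariants.comp ((S.continuous_right₁.comp (by fun_prop)).prodMk
    (S.continuous_right₂.comp (by fun_prop)))

variable {S}

theorem tendsto_flow_of_lt {l : Filter (ℝ × ℝ)} (hl : l ≤ 𝓝 (t, x))
    (h : ∀ᶠ z in l, z.2 + c * z.1 < S.front) :
    Tendsto (fun z => S.flow c z.1 z.2) l (𝓝 (S.leftState (x + c * t) (x - c * t))) :=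
  ((S.continuous_leftState_flow.tendsto (t, x)).mono_left hl).congr'
    (h.mono fun _ hz => (S.state_of_lt hz _).symm)

theorem tendsto_flow_of_le {l : Filter (ℝ × ℝ)} (hl : l ≤ 𝓝 (t, x))
    (h : ∀ᶠ z in l, S.front ≤ z.2 + c * z.1) :
    Tendsto (fun z => S.flow c z.1 z.2) l (𝓝 (S.rightState (x + c * t) (x - c * t))) :=
  ((S.continuous_rightState_flow.tendsto (t, x)).mono_left hl).congr'
    (h.mono fun _ hz => (S.state_of_le hz _).symm)

theorem continuousAt_flow (h : x + c * t ≠ S.front) :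
    ContinuousAt (fun z : ℝ × ℝ => S.flow c z.1 z.2) (t, x) := by
  have hphase : Continuous fun z : ℝ × ℝ => z.2 + c * z.1 := by fun_prop
  rcases h.lt_or_gt with h | h
  · rw [ContinuousAt, flow, S.state_of_lt h]
    exact tendsto_flow_of_lt le_rfl (hphase.continuousAt.eventually_lt_const h)
  · rw [ContinuousAt, flow, S.state_of_le h.le]
    exact tendsto_flow_of_le le_rfl
      ((continuousAt_const.eventually_lt hphase.continuousAt h).mono fun _ => le_of_lt)

theorem continuousAt_flow_slice (h : x + c * t ≠ S.front) : ContinuousAt (S.flow c t) x :=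
  (continuousAt_flow h).comp (f := fun x => (t, x)) (by fun_prop)

theorem map_mk_nhdsWithin_le (t x : ℝ) (s : Set ℝ) : map (Prod.mk t) (𝓝[s] x) ≤ 𝓝 (t, x) :=
  (Continuous.prodMk_right t).continuousWithinAt

theorem tendsto_flow_left (h : x + c * t = S.front) :
    Tendsto (S.flow c t) (𝓝[<] x) (𝓝 (S.leftState S.front (x - c * t))) := by
  rw [← h]
  refine tendsto_map'_iff.1 (tendsto_flow_of_lt (map_mk_nhdsWithin_le t x (Iio x))
    (eventually_map.2 ?_))
  filter_upwards [self_mem_nhdsWithin] with y hy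
  linarith [mem_Iio.1 hy]

theorem tendsto_flow_upperSector (h : x + c * t = S.front) :
    Tendsto (fun z : ℝ × ℝ => S.flow c z.1 z.2) (𝓝[upperSector c t x] (t, x))
      (𝓝 (S.rightState S.front (x - c * t))) := by
  rw [← h]
  refine tendsto_flow_of_le nhdsWithin_le_nhds ?_
  filter_upwards [self_mem_nhdsWithin] with z hz
  linarith [(abs_lt.1 hz.2).1]

theorem continuousWithinAt_flow (c t x : ℝ) : ContinuousWithinAt (S.flow c t) (Ici x) x := by
  rcases lt_or_ge (x + c * t) S.front with h | h
  · exact (continuousAt_flow_slice h.ne).continuousWithinAt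
  · rw [ContinuousWithinAt, flow, S.state_of_le h]
    refine tendsto_map'_iff.1 (tendsto_flow_of_le (map_mk_nhdsWithin_le t x (Ici x))
      (eventually_map.2 ?_))
    filter_upwards [self_mem_nhdsWithin] with y hy
    linarith [mem_Ici.1 hy]

end Continuity

section FrontTracking

theorem exists_riemannMiddle_flow (hpos : 0 < (S.flow c t x).2) : ∃ L M : State,
    Tendsto (S.flow c t) (𝓝[<] x) (𝓝 L) ∧
    Tendsto (fun z : ℝ × ℝ => S.flow c z.1 z.2) (𝓝[upperSector c t x] (t, x)) (𝓝 M) ∧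
    RiemannMiddle L M (S.flow c t x) := by
  by_cases h : x + c * t = S.front
  · have hflow : S.flow c t x = S.rightState S.front (x - c * t) := by
      rw [flow, h, S.state_of_le le_rfl]
    rw [hflow] at hpos ⊢
    exact ⟨_, _, tendsto_flow_left h, tendsto_flow_upperSector h,
      riemannMiddle_of_wave₁ (S.wave₁ _ ((div_pos_iff_of_pos_right two_pos).1 hpos))⟩
  · exact ⟨_, _, (continuousAt_flow_slice h).tendsto.mono_left nhdsWithin_le_nhds,
      (continuousAt_flow h).tendsto.mono_left nhdsWithin_le_nhds, riemannMiddle_self hpos⟩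

theorem lt_front_iff_of_ne {y t' : ℝ} (hc : 0 < c) (htt' : t ≤ t')
    (h : ∀ r ∈ Icc t t', y + c * r + c * r ≠ S.front) :
    y + c * t' + c * t' < S.front ↔ y + c * t + c * t < S.front := by
  refine ⟨fun hlt => by nlinarith, fun hlt => ?_⟩
  by_contra! hge
  have hphase : Continuous fun r => y + c * r + c * r := by fun_prop
  obtain ⟨r, hr, hfront⟩ := intermediate_value_Icc htt' hphase.continuousOn ⟨hlt.le, hge⟩
  exact h r hr hfront

theorem isFrontTracking_flow (hc : 0 < c) : IsFrontTracking c (S.flow c) := by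
  refine ⟨fun _ _ _ => S.density_flow_nonneg, fun t _ x => continuousWithinAt_flow c t x,
    fun _ _ _ hpos => S.exists_riemannMiddle_flow hpos, {S.front}, ∅, ?_, ?_, ?_⟩
  · intro t _ x hA _
    exact continuousAt_flow_slice (by simpa only [Finset.mem_singleton] using hA)
  · intro y _ t t' _ _ _
    simp only [w₁_flow, sub_add_cancel]
  · intro y _ t t' _ htt' hA
    simp only [w₂_flow, add_sub_cancel_right,
      S.lt_front_iff_of_ne hc htt' (by simpa only [Finset.mem_singleton] using hA)]

end FrontTracking

section TotalVariation

variable {S}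

theorem boundedVariationOn_flow (hl₁ : BoundedVariationOn S.left₁ (Iic S.front))
    (hr₁ : BoundedVariationOn S.right₁ (Ici S.front))
    (hl₂ : BoundedVariationOn S.left₂ (Iic (S.front - 2 * (c * t))))
    (hr₂ : BoundedVariationOn S.right₂ (Ici (S.front - 2 * (c * t)))) :
    BoundedVariationOn (S.flow c t) univ := by
  have hadd : Monotone fun x => x + c * t := monotone_id.add_const _
  have hsub : Monotone fun x => x - c * t := fun _ _ h => sub_le_sub_right h _
  have hw₁ : BoundedVariationOn (fun x => w₁ (S.flow c t x)) univ := by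
    simp only [w₁_flow, ← lt_sub_iff_add_lt]
    exact boundedVariationOn_ite_lt
      (boundedVariationOn_comp_monotone hl₁ hadd fun x hx => by grind)
      (boundedVariationOn_comp_monotone hr₁ hadd fun x hx => by grind)
  have hw₂ : BoundedVariationOn (fun x => w₂ (S.flow c t x)) univ := by
    simp only [w₂_flow, ← lt_sub_iff_add_lt]
    exact boundedVariationOn_ite_lt
      (boundedVariationOn_comp_monotone hl₂ hsub fun x hx => by grind)
      (boundedVariationOn_comp_monotone hr₂ hsub fun x hx => by grind)
  simpa only [Function.comp_def, ofInvariants_w] using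
    lipschitzWith_ofInvariants.comp_boundedVariationOn (boundedVariationOn_prodMk hw₁ hw₂)

/- On the right of the front `w₂ = 2 ρ - w₁`, where `w₁` has bounded variation. -/
theorem eVariationOn_density_flow {q₀ : ℝ} (hfront : S.front ≤ q₀ + 2 * (c * t))
    (hr₁ : BoundedVariationOn S.right₁ (Ici S.front))
    (hr₂ : ¬ BoundedVariationOn S.right₂ (Ioi q₀)) :
    eVariationOn (fun x => (S.flow c t x).2) (Ioi (q₀ + c * t)) = ⊤ := by
  by_contra hρ
  have hadd (a : ℝ) : Monotone fun x => x + a := monotone_id.add_const a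
  have hdensity : BoundedVariationOn (fun q => 2 * (S.flow c t (q + c * t)).2 + 0) (Ioi q₀) :=
    boundedVariationOn_mul_add_const (boundedVariationOn_comp_monotone hρ (hadd _)
      fun q hq => by grind) 2 0
  have hw₁ : BoundedVariationOn (fun q => S.right₁ (q + 2 * (c * t))) (Ioi q₀) :=
    boundedVariationOn_comp_monotone hr₁ (hadd _) fun q hq => by grind
  refine hr₂ (ne_of_eq_of_ne (eVariationOn.eq_of_eqOn fun q hq => ?_)
    (boundedVariationOn_sub hdensity hw₁))
  have hp : S.front ≤ q + c * t + c * t := by linarith [mem_Ioi.1 hq]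
  rw [Pi.sub_apply, flow, S.state_of_le hp, add_sub_cancel_right, rightState, ofInvariants,
    add_assoc q, ← two_mul]
  ring

theorem tendsto_eVariationOn_density_flow {q₀ : ℝ} (hfront : S.front ≤ q₀ + 2 * (c * t))
    (hr₁ : BoundedVariationOn S.right₁ (Ici S.front))
    (hr₂ : ¬ BoundedVariationOn S.right₂ (Ioi q₀)) :
    Tendsto (fun τ => eVariationOn (fun x => (S.flow c τ x).2) (Ioi (q₀ + c * t))) (𝓝 t)
      (𝓝 ⊤) := by
  refine tendsto_eVariationOn_top (fun x hx => ?_) (eVariationOn_density_flow hfront hr₁ hr₂)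
  have hx' : S.front < x + c * t := by linarith [mem_Ioi.1 hx]
  exact ((continuousAt_flow hx'.ne').comp (f := fun τ => (τ, x)) (by fun_prop)).snd

end TotalVariation

end SingleShock

section Construction

theorem wave₁_leftDensity_rightDensity {q : ℝ} (hq : q ≠ 0) :
    Wave₁ (ofInvariants 0 (2 * leftDensity q)) (ofInvariants 1 (2 * rightDensity q - 1)) := by
  convert wave₁_shock (shockParam_pos hq) (by linarith [(shockParam_mem_Icc q).2]) using 1 <;>
  · simp only [ofInvariants, leftDensity, rightDensity, Prod.mk.injEq]
    constructor <;> ring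

theorem rightDensity_zero : rightDensity 0 = 0 := by
  simp [rightDensity, shockParam, trunc, osc, shockRight]

/-- The shock `x = 1 - c t`, across which `w₁` jumps from `0` to `1`, crossed by 2-waves which
oscillate like `shockLeft` on its left and like `shockRight` on its right. The 1-waves on its left
keep the density positive there, and a 1-compression behind it raises the density above `1` for
`p ≥ 2`. -/
noncomputable def oscillatingShock : SingleShock where
  front := 1
  left₁ p := -1 * trunc p + 1
  right₁ p := 2 * trunc (p + -2) + 3
  left₂ q := 2 * leftDensity q + 0
  right₂ q := 2 * rightDensity q + -1
  continuous_left₁ := (continuous_trunc.const_mul (-1)).add_const 1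
  continuous_right₁ := ((continuous_trunc.comp (continuous_add_const (-2))).const_mul 2).add_const 3
  continuous_left₂ := (continuous_leftDensity.const_mul 2).add_const 0
  continuous_right₂ := (continuous_rightDensity.const_mul 2).add_const (-1)
  left_nonneg p _ q := by linarith [(trunc_mem_Icc p).2, (leftDensity_mem_Icc q).1]
  right_nonneg p _ q := by linarith [(trunc_mem_Icc (p + -2)).1, (rightDensity_mem_Icc q).1]
  wave₁ q h := by
    have hq : q ≠ 0 := by
      rintro rfl
      norm_num [trunc, rightDensity_zero] at h
    convert wave₁_leftDensity_rightDensity hq using 2 <;> norm_num [trunc, sub_eq_add_neg]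

theorem front_oscillatingShock : oscillatingShock.front = 1 := rfl

theorem density_oscillatingShock_of_lt {p : ℝ} (h : p < 1) (q : ℝ) :
    (oscillatingShock.state p q).2 = (1 - trunc p) / 2 + leftDensity q := by
  rw [oscillatingShock.state_of_lt h]
  simp only [SingleShock.leftState, ofInvariants, oscillatingShock]
  ring

theorem density_oscillatingShock_of_le {p : ℝ} (h : 1 ≤ p) (q : ℝ) :
    (oscillatingShock.state p q).2 = 1 + trunc (p - 2) + rightDensity q := by
  rw [oscillatingShock.state_of_le h]
  simp only [SingleShock.rightState, ofInvariants, oscillatingShock, sub_eq_add_neg]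
  ring

theorem density_oscillatingShock_pos {p q : ℝ} (h : (p, q) ≠ (1, 0)) :
    0 < (oscillatingShock.state p q).2 := by
  rcases lt_or_ge p 1 with hp | hp
  · have htrunc : trunc p < 1 := max_lt (by norm_num) (min_lt_of_right_lt hp)
    rw [density_oscillatingShock_of_lt hp]
    linarith [(leftDensity_mem_Icc q).1]
  rw [density_oscillatingShock_of_le hp]
  rcases hp.eq_or_lt with rfl | hp
  · linarith [(trunc_mem_Icc (1 - 2)).1, rightDensity_pos fun hq : q = 0 => h (by rw [hq])]
  · have htrunc : -1 < trunc (p - 2) := lt_max_of_lt_right (lt_min (by norm_num) (by linarith))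
    linarith [(rightDensity_mem_Icc q).1]

theorem one_le_density_flow_oscillatingShock {c t x : ℝ} (h : 2 ≤ x + c * t) :
    1 ≤ (oscillatingShock.flow c t x).2 := by
  have htrunc : 0 ≤ trunc (x + c * t - 2) :=
    le_max_of_le_right (le_min zero_le_one (by linarith))
  rw [SingleShock.flow, density_oscillatingShock_of_le (by linarith)]
  linarith [(rightDensity_mem_Icc (x - c * t)).1]

theorem le_density_flow_zero_oscillatingShock (c x : ℝ) :
    1 / 5120 ≤ (oscillatingShock.flow c 0 x).2 := by
  rw [SingleShock.flow_zero]
  rcases lt_or_ge x 1 with h | h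
  · rw [density_oscillatingShock_of_lt h]
    rcases le_total x (1 / 2) with hx | hx
    · have htrunc : trunc x ≤ 1 / 2 := max_le (by norm_num) (min_le_of_right_le hx)
      linarith [(leftDensity_mem_Icc x).1]
    · linarith [le_leftDensity hx, (trunc_mem_Icc x).2]
  · rw [density_oscillatingShock_of_le h]
    linarith [le_rightDensity (by linarith : 1 / 2 ≤ x), (trunc_mem_Icc (x - 2)).1]

theorem oscillatingShock_state_mem {r p q : ℝ} (h : r ≤ (oscillatingShock.state p q).2) :
    oscillatingShock.state p q ∈ Icc (-4 : ℝ) 4 ×ˢ Icc r 4 := by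
  have hA := leftDensity_mem_Icc q
  have hB := rightDensity_mem_Icc q
  have hp := trunc_mem_Icc p
  have hp' := trunc_mem_Icc (p + -2)
  suffices (oscillatingShock.state p q).1 ∈ Icc (-4 : ℝ) 4 ∧ (oscillatingShock.state p q).2 ≤ 4 from
    ⟨this.1, h, this.2⟩
  unfold SingleShock.state SingleShock.leftState SingleShock.rightState
  split_ifs <;> simp only [ofInvariants, oscillatingShock, mem_Icc] at * <;>
    exact ⟨⟨by linarith, by linarith⟩, by linarith⟩

theorem boundedVariationOn_right₁_oscillatingShock (s : Set ℝ) :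
    BoundedVariationOn oscillatingShock.right₁ s :=
  boundedVariationOn_mul_add_const (boundedVariationOn_comp_monotone
    (boundedVariationOn_trunc univ) (monotone_id.add_const (-2)) fun _ _ => mem_univ _) 2 3

theorem boundedVariationOn_flow_oscillatingShock {c t : ℝ} (h : c * t < 1 / 2) :
    BoundedVariationOn (oscillatingShock.flow c t) univ := by
  refine SingleShock.boundedVariationOn_flow ?_ (boundedVariationOn_right₁_oscillatingShock _)
    ?_ ?_
  · exact boundedVariationOn_mul_add_const (boundedVariationOn_trunc _) (-1) 1
  · exact (boundedVariationOn_mul_add_const boundedVariationOn_leftDensity 2 0).mono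
      (subset_univ _)
  · refine boundedVariationOn_mul_add_const (boundedVariationOn_rightDensity ?_) 2 (-1)
    linarith [front_oscillatingShock]

theorem not_boundedVariationOn_right₂_oscillatingShock :
    ¬ BoundedVariationOn oscillatingShock.right₂ (Ioi 0) := fun h => by
  refine boundedVariationOn_mul_add_const h (1 / 2) (1 / 2)
    (Eq.trans (congrArg (eVariationOn · (Ioi 0)) (funext fun q => ?_))
      eVariationOn_rightDensity_Ioi)
  simp only [oscillatingShock]
  ring

theorem eVariationOn_density_flow_oscillatingShock {c t : ℝ} (h : 1 / 2 ≤ c * t) :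
    eVariationOn (fun x => (oscillatingShock.flow c t x).2) (Ici 0) = ⊤ := by
  have hfront : oscillatingShock.front ≤ 0 + 2 * (c * t) := by
    linarith [front_oscillatingShock]
  refine top_unique ((SingleShock.eVariationOn_density_flow hfront
    (boundedVariationOn_right₁_oscillatingShock _)
    not_boundedVariationOn_right₂_oscillatingShock).ge.trans
    (eVariationOn.mono _ fun x hx => mem_Ici.2 ?_))
  linarith [mem_Ioi.1 hx]

theorem tendsto_eVariationOn_density_flow_oscillatingShock {c t : ℝ} (h : 1 / 2 ≤ c * t) :
    Tendsto (fun τ => eVariationOn (fun x => (oscillatingShock.flow c τ x).2) univ) (𝓝 t)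
      (𝓝 ⊤) := by
  have hfront : oscillatingShock.front ≤ 0 + 2 * (c * t) := by
    linarith [front_oscillatingShock]
  exact tendsto_nhds_top_mono' (SingleShock.tendsto_eVariationOn_density_flow hfront
    (boundedVariationOn_right₁_oscillatingShock _) not_boundedVariationOn_right₂_oscillatingShock)
    fun _ => eVariationOn.mono _ (subset_univ _)

theorem density_flow_oscillatingShock_pos {c t x : ℝ} (hc : 0 < c)
    (h : (t, x) ≠ (1 / (2 * c), 1 / 2)) : 0 < (oscillatingShock.flow c t x).2 := by
  refine density_oscillatingShock_pos fun hpq => h ?_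
  obtain ⟨hp, hq⟩ := Prod.mk.inj hpq
  rw [Prod.mk.injEq, eq_div_iff (by positivity)]
  constructor <;> linarith

theorem weightedVariation_oscillatingShock_lt_top_iff {W₁ W₂ : State × State → ℝ}
    (h₁ : IsWeight W₁) (h₂ : IsWeight W₂) {c t r : ℝ} (hr : 0 < r) {s : Set ℝ}
    (h : ∀ x ∈ s, r ≤ (oscillatingShock.flow c t x).2) :
    weightedVariation W₁ W₂ (oscillatingShock.flow c t) s < ⊤ ↔
      BoundedVariationOn (oscillatingShock.flow c t) s :=
  weightedVariation_lt_top_iff h₁ h₂ (isCompact_Icc.prod isCompact_Icc)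
    (fun _ hU => hr.trans_le hU.2.1) fun x hx => oscillatingShock_state_mem (h x hx)

end Construction

end PSystem

theorem mainTheorem1 :
    ∃ (ubar rhobar : ℝ → ℝ) (rho0 : ℝ),
      BoundedVariationOn ubar univ ∧ BoundedVariationOn rhobar univ ∧
      0 < rho0 ∧ (∀ x, rho0 ≤ rhobar x) ∧
      ∀ c : ℝ, 0 < c → ∃ (U : ℝ → ℝ → PSystem.State) (t₂ x₂ t₃ : ℝ),
        PSystem.IsFrontTracking c U ∧
        (∀ x, U 0 x = (ubar x, rhobar x)) ∧
        0 < t₂ ∧ t₂ < t₃ ∧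
        (∀ t ≥ 0, ∀ x, (t, x) ≠ (t₂, x₂) → 0 < (U t x).2) ∧
        -- blow up at time `t₂`
        (∀ t ≥ 0, t < t₂ → BoundedVariationOn (fun x => (U t x).1) univ ∧
          BoundedVariationOn (fun x => (U t x).2) univ) ∧
        Tendsto (fun t => eVariationOn (fun x => (U t x).2) univ) (𝓝[<] t₂) (𝓝 ⊤) ∧
        -- infinite total variation at uniformly positive density, at time `t₃`
        (∀ x ≥ 0, 1 ≤ (U t₃ x).2) ∧
        eVariationOn (fun x => (U t₃ x).2) (Ici 0) = ⊤ ∧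
        -- no weight on wave strengths controls the total variation
        (∀ W₁ W₂ : PSystem.State × PSystem.State → ℝ, PSystem.IsWeight W₁ → PSystem.IsWeight W₂ →
          PSystem.weightedVariation W₁ W₂ (U 0) univ < ⊤ ∧
          PSystem.weightedVariation W₁ W₂ (U t₃) (Ici 0) = ⊤) := by
  have hBV {c t : ℝ} (ht : c * t < 1 / 2) := PSystem.boundedVariationOn_prod_iff.1
    (PSystem.boundedVariationOn_flow_oscillatingShock ht)
  have hinitial := PSystem.le_density_flow_zero_oscillatingShock
  refine ⟨_, _, 1 / 5120, (@hBV 1 0 (by norm_num)).1, (@hBV 1 0 (by norm_num)).2, by norm_num,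
    hinitial 1, fun c hc => ?_⟩
  have ht₂ : c * (1 / (2 * c)) = 1 / 2 := by field_simp
  have ht₃ : c * (2 / c) = 2 := by field_simp
  have hdense : ∀ x ≥ 0, 1 ≤ (PSystem.oscillatingShock.flow c (2 / c) x).2 := fun x hx =>
    PSystem.one_le_density_flow_oscillatingShock (by linarith)
  have hinfinite := PSystem.eVariationOn_density_flow_oscillatingShock
    (by linarith : 1 / 2 ≤ c * (2 / c))
  refine ⟨PSystem.oscillatingShock.flow c, 1 / (2 * c), 1 / 2, 2 / c,
    PSystem.oscillatingShock.isFrontTracking_flow hc,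
    fun x => by simp only [PSystem.SingleShock.flow_zero], by positivity,
    (div_lt_div_iff₀ (by positivity) hc).2 (by linarith),
    fun t _ x h => PSystem.density_flow_oscillatingShock_pos hc h,
    fun t _ ht => hBV (ht₂ ▸ mul_lt_mul_of_pos_left ht hc),
    (PSystem.tendsto_eVariationOn_density_flow_oscillatingShock ht₂.ge).mono_left
      nhdsWithin_le_nhds, hdense, hinfinite, fun W₁ W₂ h₁ h₂ => ⟨?_, ?_⟩⟩
  · exact (PSystem.weightedVariation_oscillatingShock_lt_top_iff h₁ h₂ (by norm_num)
      fun x _ => hinitial c x).2 (PSystem.boundedVariationOn_flow_oscillatingShock (by norm_num))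
  · exact not_lt_top_iff.1 fun h => (PSystem.boundedVariationOn_prod_iff.1
      ((PSystem.weightedVariation_oscillatingShock_lt_top_iff h₁ h₂ one_pos hdense).1 h)).2
        hinfinite
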